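/- Work in $\mathbb R^n$ with the Euclidean norm and let $\overline{\mathbb R}=(-\infty,+\infty]$. **Notation.** For $f:\mathbb R^n\to\overline{\mathbb R}$ and $\lambda>0$ put $e_\lambda f(x)=\inf_y\{f(y)+\frac1{2\lambda}\|y-x\|^2\}$ and $P_\lambda f(x)=\operatorname{argmin}_y\{f(y)+\frac1{2\lambda}\|y-x\|^2\}$, and $\operatorname{Fix}P_\lambda f=\{z: z\in P_\lambda f(z)\}$. $f$ is *prox-bounded* if $e_\lambda f(x)>-\infty$ for some $\lambda>0$ and some $x$; its threshold $\lambda_f\in(0,+\infty]$ is the supremum of all such $\lambda$. $\partial f$ is the Mordukhovich limiting subdifferential, and $v\in\partial_p^\lambda f(x)$ means $f(x)<\infty$ and $f(y)\ge f(x)+\langle v,y-x\rangle-\frac1{2\lambda}\|y-x\|^2$ for all $y$. $f$ is *prox-regular at $x_0$ for $v_0\in\partial f(x_0)$* if there are $\varepsilon>0,\rho\ge0$ with $f(y)\ge f(x)+\langle v,y-x\rangle-\frac\rho2\|y-x\|^2$ whenever $\|x-x_0\|<\varepsilon$, $\|y-x_0\|<\varepsilon$, $v\in\partial f(x)$, $\|v-v_0\|<\varepsilon$,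 $f(x)<f(x_0)+\varepsilon$. It is *prox-regular on a set* if it is so at every point $x_0$ of the set for every $v_0\in\partial f(x_0)$, and *prox-regular around $\bar x$* if it is prox-regular on a neighborhood of $\bar x$. $f$ is *variationally convex at $\bar x$ for $\bar v\in\partial f(\bar x)$* if there are convex neighborhoods $U$ of $\bar x$ and $V$ of $\bar v$, a lsc convex $\varphi:\mathbb R^n\to\overline{\mathbb R}$ with $\varphi\le f$ on $U$, and $\varepsilon>0$ such that, with $U_\varepsilon=\{x\in U: f(x)<f(\bar x)+\varepsilon\}$, $[U_\varepsilon\times V]\cap\operatorname{gph}\partial f=[U\times V]\cap\operatorname{gph}\partial\varphi$ and $f(x)=\varphi(x)$ at every common element $(x,v)$. Call an open convex neighborhood $U_\lambda$ of $\bar x$ *admissible for $\lambda$* if $P_\lambda f(\bar x)=\{\bar x\}$, $P_\lambda f$ is single-valued on $U_\lambda$, and the following hold: $\partial_p^\lambda f$ is monotone and maximally monotone relative to $W_\lambda=\{(x,v): x+\lambda v\in U_\lambda\}$; $P_\lambda f$ is firmly nonexpansive, $\alpha$-averaged for some $\alpha\in(0,1)$, and nonexpansive on $U_\lambda$; $e_\lambda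 f$ is finite, convex and differentiable on $U_\lambda$, and $\nabla e_\lambda f$ is $\lambda$-cocoercive on $U_\lambda$. (A mapping $T$ is firmly nonexpansive on $U$ if $\|Tx-Ty\|^2\le\langle x-y,Tx-Ty\rangle$ for all $x,y\in U$; it is $\alpha$-averaged on $U$ if $T=(1-\alpha)\operatorname{Id}+\alpha N$ on $U$ with $N$ nonexpansive on $U$; it is $c$-cocoercive if $cT$ is firmly nonexpansive. A set-valued $A$ is monotone relative to $W$ if $\langle x_1-x_2,v_1-v_2\rangle\ge0$ for all $(x_i,v_i)\in W\cap\operatorname{gph}A$; it is maximally monotone relative to $W$ if moreover $W\cap\operatorname{gph}A$ is not properly contained in $W\cap\operatorname{gph}A'$ for any $A'$ that is monotone relative to $W$.) **Theorem (Krasnosel'skiĭ–Mann algorithm under variational convexity).** Let $f:\mathbb R^n\to\overline{\mathbb R}$ be proper, lower semicontinuous and prox-bounded with threshold $\lambda_f>0$. Suppose that $f$ is variationally convex at $\bar x$ for $0\in\partial f(\bar x)$ and that $f$ is prox-regular around $\bar x$. Then there is $0<\bar\lambda\le\lambda_f$ such that for every $0<\lambda<\bar\lambda$ there exists a neighborhood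 $U_\lambda$ of $\bar x$ that is admissible for $\lambda$. Moreover, let $0<\lambda<\lambda_f$, let $U_\lambda$ be any neighborhood of $\bar x$ admissible for $\lambda$, let $C\subset\operatorname{int}U_\lambda$ be a closed ball of positive radius centered at $\bar x$ on which $f$ is prox-regular, let $x_1\in C$, and let $(\mu_k)_{k\ge1}$ be a sequence in $[0,1]$ with $\sum_{k=1}^\infty\mu_k(1-\mu_k)=\infty$. Define $$x_{k+1}=\mu_kP_\lambda f(x_k)+(1-\mu_k)x_k\qquad(k\ge1).$$ Then $\operatorname{Fix}P_\lambda f\cap C\ne\varnothing$ and: 1. $(x_k)$ stays in $C$ and is Fejér monotone with respect to $\operatorname{Fix}P_\lambda f\cap C$, i.e. $\|x_{k+1}-z\|\le\|x_k-z\|$ for all $k$ and all $z\in\operatorname{Fix}P_\lambda f\cap C$; 2. $P_\lambda f(x_k)-x_k\to0$; 3. $(x_k)$ converges to a point $x^*\in\operatorname{Fix}P_\lambda f\cap C$; 4. $x^*$ is a local minimizer of $f$. -/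

import Mathlib

open Filter Topology

namespace VarConvex

section Functions

variable {E : Type*} [NormedAddCommGroup E] [InnerProductSpace ℝ E]

/-- Proper functions with values in `(-∞, +∞]`. -/
def Proper (f : E → EReal) : Prop :=
  (∀ x, f x ≠ ⊥) ∧ ∃ x, f x < ⊤

/-- Convexity on a set `U` of an extended-real-valued function: the part of the epigraph that lies
over `U` is convex. -/
def EConvexOn (U : Set E) (g : E → EReal) : Prop :=
  Convex ℝ {p : E × ℝ | p.1 ∈ U ∧ g p.1 ≤ (p.2 : EReal)}

/-- The objective `y ↦ f y + ‖y - x‖² / (2λ)` of the proximal problem at `x`. -/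
noncomputable def proxObjective (f : E → EReal) (lam : ℝ) (x y : E) : EReal :=
  f y + ((1 / (2 * lam) * ‖y - x‖ ^ 2 : ℝ) : EReal)

/-- The Moreau envelope `e_λ f`. -/
noncomputable def moreauEnvelope (f : E → EReal) (lam : ℝ) (x : E) : EReal :=
  ⨅ y, proxObjective f lam x y

/-- The (set-valued) proximal mapping `P_λ f`. -/
def prox (f : E → EReal) (lam : ℝ) (x : E) : Set E :=
  {y | ∀ z, proxObjective f lam x y ≤ proxObjective f lam x z}

/-- The fixed points of the set-valued mapping `P_λ f`. -/
def fixProx (f : E → EReal) (lam : ℝ) : Set E :=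
  {z | z ∈ prox f lam z}

/-- Prox-boundedness. -/
def ProxBounded (f : E → EReal) : Prop :=
  ∃ lam : ℝ, 0 < lam ∧ ∃ x, ⊥ < moreauEnvelope f lam x

/-- The threshold `λ_f` of prox-boundedness, possibly `+∞`. -/
noncomputable def proxThreshold (f : E → EReal) : EReal :=
  sSup {t : EReal | ∃ lam : ℝ, t = (lam : EReal) ∧ 0 < lam ∧ ∃ x, ⊥ < moreauEnvelope f lam x}

/-- The set of regular subgradients:
`f y ≥ f x + ⟨v, y - x⟩ + o(‖y - x‖)`. -/
def regularSubdiff (f : E → EReal) (x : E) : Set E :=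
  {v | f x < ⊤ ∧ ∀ ε : ℝ, 0 < ε →
    ∀ᶠ y in 𝓝 x, f x + ((inner ℝ v (y - x) - ε * ‖y - x‖ : ℝ) : EReal) ≤ f y}

/-- The Mordukhovich limiting subdifferential `∂f`. -/
def limitingSubdiff (f : E → EReal) (x : E) : Set E :=
  {v | f x < ⊤ ∧ ∃ (xs vs : ℕ → E), (∀ k, vs k ∈ regularSubdiff f (xs k)) ∧
    Tendsto vs atTop (𝓝 v) ∧ Tendsto xs atTop (𝓝 x) ∧
    Tendsto (fun k => f (xs k)) atTop (𝓝 (f x))}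

/-- The `λ`-level proximal subdifferential `∂_p^λ f`. -/
def levelProxSubdiff (f : E → EReal) (lam : ℝ) (x : E) : Set E :=
  {v | f x < ⊤ ∧
    ∀ y, f x + ((inner ℝ v (y - x) - 1 / (2 * lam) * ‖y - x‖ ^ 2 : ℝ) : EReal) ≤ f y}

/-- The graph of a set-valued mapping. -/
def graph (A : E → Set E) : Set (E × E) :=
  {p | p.2 ∈ A p.1}

/-- `f` is prox-regular at `xbar` for `vbar ∈ ∂f(xbar)`. -/
def ProxRegularFor (f : E → EReal) (xbar vbar : E) : Prop :=
  vbar ∈ limitingSubdiff f xbar ∧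
  ∃ ε ρ : ℝ, 0 < ε ∧ 0 ≤ ρ ∧
    ∀ x ∈ Metric.ball xbar ε, f x < f xbar + (ε : EReal) →
    ∀ v ∈ limitingSubdiff f x, v ∈ Metric.ball vbar ε →
    ∀ y ∈ Metric.ball xbar ε,
      f x + ((inner ℝ v (y - x) - ρ / 2 * ‖y - x‖ ^ 2 : ℝ) : EReal) ≤ f y

/-- `f` is prox-regular at `x`: it is so for every limiting subgradient at `x`. -/
def ProxRegularAt (f : E → EReal) (x : E) : Prop :=
  ∀ v ∈ limitingSubdiff f x, ProxRegularFor f x v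

/-- `f` is prox-regular at every point of `S`. -/
def ProxRegularOn (f : E → EReal) (S : Set E) : Prop :=
  ∀ x ∈ S, ProxRegularAt f x

/-- `f` is prox-regular at every point of some neighborhood of `xbar`. -/
def ProxRegularAround (f : E → EReal) (xbar : E) : Prop :=
  ∃ N ∈ 𝓝 xbar, ProxRegularOn f N

/-- `f` is variationally convex at `xbar` for `vbar ∈ ∂f(xbar)`. -/
def VariationallyConvexAt (f : E → EReal) (xbar vbar : E) : Prop :=
  vbar ∈ limitingSubdiff f xbar ∧
  ∃ U ∈ 𝓝 xbar, ∃ V ∈ 𝓝 vbar, Convex ℝ U ∧ Convex ℝ V ∧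
  ∃ φ : E → EReal, (∀ x, φ x ≠ ⊥) ∧ LowerSemicontinuous φ ∧ EConvexOn Set.univ φ ∧
    (∀ x ∈ U, φ x ≤ f x) ∧
  ∃ ε : ℝ, 0 < ε ∧
    ({x | x ∈ U ∧ f x < f xbar + (ε : EReal)} ×ˢ V) ∩ graph (limitingSubdiff f)
      = (U ×ˢ V) ∩ graph (limitingSubdiff φ) ∧
    ∀ p ∈ (U ×ˢ V) ∩ graph (limitingSubdiff φ), f p.1 = φ p.1

/-- `A` is monotone relative to `W`. -/
def MonotoneRel (A : E → Set E) (W : Set (E × E)) : Prop :=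
  ∀ p ∈ graph A ∩ W, ∀ q ∈ graph A ∩ W, 0 ≤ inner ℝ (p.1 - q.1) (p.2 - q.2)

/-- `A` is maximally monotone relative to `W`. -/
def MaxMonotoneRel (A : E → Set E) (W : Set (E × E)) : Prop :=
  MonotoneRel A W ∧
  ¬ ∃ A' : E → Set E, graph A ∩ W ⊆ graph A' ∩ W ∧ graph A' ∩ W ≠ graph A ∩ W ∧ MonotoneRel A' W

/-- `T` is firmly nonexpansive on `U`. -/
def FirmlyNonexpansiveOn (T : E → E) (U : Set E) : Prop :=
  ∀ x ∈ U, ∀ y ∈ U, ‖T x - T y‖ ^ 2 ≤ inner ℝ (x - y) (T x - T y)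

/-- `T` is nonexpansive on `U`. -/
def NonexpansiveOn (T : E → E) (U : Set E) : Prop :=
  ∀ x ∈ U, ∀ y ∈ U, ‖T x - T y‖ ≤ ‖x - y‖

/-- `T` is `α`-averaged on `U`. -/
def AveragedOn (α : ℝ) (T : E → E) (U : Set E) : Prop :=
  ∃ N : E → E, NonexpansiveOn N U ∧ ∀ x ∈ U, T x = (1 - α) • x + α • N x

/-- `T` is `c`-cocoercive on `U`. -/
def CocoerciveOn (c : ℝ) (T : E → E) (U : Set E) : Prop :=
  FirmlyNonexpansiveOn (fun x => c • T x) U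

/-- Fejér monotonicity of a sequence with respect to a set. -/
def FejerMonotone (x : ℕ → E) (S : Set E) : Prop :=
  ∀ z ∈ S, ∀ k, ‖x (k + 1) - z‖ ≤ ‖x k - z‖

/-- `U` is a neighborhood `U_λ` of the stationary point `xbar` (the case `vbar = 0`) of the kind
provided by the characterization of variational convexity, and `P` is `P_λ f` on `U`:
`U` is an open convex neighborhood of `xbar`, `P_λ f(xbar) = xbar`, the proximal mapping is
single-valued on `U`, and all the (equivalent) properties of the characterization hold on `U`. -/
structure IsProxNeighborhood [CompleteSpace E] (f : E → EReal) (xbar : E) (lam : ℝ) (U : Set E)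
    (P : E → E) : Prop where
  isOpen : IsOpen U
  convex : Convex ℝ U
  mem : xbar ∈ U
  prox_center : prox f lam xbar = {xbar}
  prox_eq : ∀ x ∈ U, prox f lam x = {P x}
  monotone : MonotoneRel (levelProxSubdiff f lam) {p | p.1 + lam • p.2 ∈ U}
  maxMonotone : MaxMonotoneRel (levelProxSubdiff f lam) {p | p.1 + lam • p.2 ∈ U}
  firmlyNonexpansive : FirmlyNonexpansiveOn P U
  averaged : ∃ α : ℝ, 0 < α ∧ α < 1 ∧ AveragedOn α P U
  nonexpansive : NonexpansiveOn P U
  envelope_convex : EConvexOn U (moreauEnvelope f lam)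
  envelope_finite : ∀ x ∈ U, moreauEnvelope f lam x ≠ ⊥ ∧ moreauEnvelope f lam x ≠ ⊤
  envelope_gradient : ∃ G : E → E,
    (∀ x ∈ U, HasGradientAt (fun y => (moreauEnvelope f lam y).toReal) (G x) x) ∧
    CocoerciveOn lam G U

end Functions

end VarConvex

namespace VarConvex

section Auxiliary

variable {E : Type*} [NormedAddCommGroup E] [InnerProductSpace ℝ E]

/-! Near `(xbar, 0)`, and at values of `f` close to `f xbar`, the graph of `∂f` is that of a convex
function `φ`, with `f = φ` along it. So the convex subgradient inequality holds between any two
points of that localized graph (`VariationallyConvexAt.exists_subgradient_inequality`). Proximal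
points of centres near `xbar` land there: `f` has a local minimum at `xbar`, which together with
prox-boundedness gives a global quadratic minorant touching `f` at `xbar`. For smaller `lam` this
minorant bounds the distance of a proximal point from `xbar` by a multiple of the distance of its
centre.

Applied to proximal points `p`, `q` of `u`, `w` with subgradients `(u - p) / lam`, `(w - q) / lam`,
the inequality makes `P` single-valued and firmly nonexpansive and the envelope convex and
differentiable. All admissibility properties follow from it (`isProxNeighborhood_of_subgradient`).

For the algorithm, `P` is nonexpansive on `U` and fixes `xbar`, so the ball `C` is invariant and the
classical Krasnosel'skiĭ–Mann argument works inside it, with compactness supplying a cluster point.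
At a fixed point the convex envelope agrees with `f` and is stationary, hence is locally minimal
there; since it lies below `f`, so is `f`. -/

theorem norm_sq_convex_comb (a b : E) (t : ℝ) :
    ‖t • a + (1 - t) • b‖ ^ 2
      = t * ‖a‖ ^ 2 + (1 - t) * ‖b‖ ^ 2 - t * (1 - t) * ‖a - b‖ ^ 2 := by
  rw [norm_add_sq_real, norm_sub_sq_real, norm_smul, norm_smul, mul_pow, mul_pow,
    inner_smul_left, inner_smul_right]
  simp only [Real.norm_eq_abs, sq_abs, conj_trivial]
  ring

/-! ### The Krasnosel'skiĭ–Mann iteration -/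

/-- The strict convexity defect of the squared norm is kept: these terms telescope along the
iteration and force the residual to zero. -/
theorem krasnoselskii_mann_step {T : E → E} {U : Set E} (hT : NonexpansiveOn T U)
    {x z : E} (hx : x ∈ U) (hz : z ∈ U) (hfix : T z = z) {t : ℝ} (ht : 0 ≤ t) :
    ‖t • T x + (1 - t) • x - z‖ ^ 2 ≤ ‖x - z‖ ^ 2 - t * (1 - t) * ‖T x - x‖ ^ 2 := by
  have h1 : t • T x + (1 - t) • x - z = t • (T x - z) + (1 - t) • (x - z) := by module
  have h2 : ‖T x - z‖ ≤ ‖x - z‖ := by simpa [hfix] using hT x hx z hz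
  have h3 : ‖T x - z‖ ^ 2 ≤ ‖x - z‖ ^ 2 := by gcongr
  rw [h1, norm_sq_convex_comb, sub_sub_sub_cancel_right]
  nlinarith

theorem krasnoselskii_mann_step_le {T : E → E} {U : Set E} (hT : NonexpansiveOn T U)
    {x z : E} (hx : x ∈ U) (hz : z ∈ U) (hfix : T z = z) {t : ℝ} (ht : 0 ≤ t ∧ t ≤ 1) :
    ‖t • T x + (1 - t) • x - z‖ ≤ ‖x - z‖ := by
  have h := krasnoselskii_mann_step hT hx hz hfix ht.1
  have h' : 0 ≤ t * (1 - t) * ‖T x - x‖ ^ 2 :=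
    mul_nonneg (mul_nonneg ht.1 (by linarith [ht.2])) (sq_nonneg _)
  exact le_of_sq_le_sq (by linarith) (norm_nonneg _)

/-- The step moves `x` by `t ‖T x - x‖`, so `T` moves by at most that, while `(1 - t) ‖T x - x‖` of
the old residual is left. Monotone residuals turn vanishing along a subsequence into convergence. -/
theorem krasnoselskii_mann_residual {T : E → E} {U : Set E} (hT : NonexpansiveOn T U)
    {x y : E} (hx : x ∈ U) {t : ℝ} (ht : 0 ≤ t ∧ t ≤ 1)
    (hy : y = t • T x + (1 - t) • x) (hyU : y ∈ U) :
    ‖T y - y‖ ≤ ‖T x - x‖ := by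
  have h1 : T y - y = (T y - T x) + (1 - t) • (T x - x) := by rw [hy]; module
  have h2 : y - x = t • (T x - x) := by rw [hy]; module
  calc ‖T y - y‖ ≤ ‖T y - T x‖ + ‖(1 - t) • (T x - x)‖ := by rw [h1]; exact norm_add_le _ _
    _ ≤ ‖y - x‖ + ‖(1 - t) • (T x - x)‖ := by gcongr; exact hT y hyU x hx
    _ = ‖T x - x‖ := by
      rw [h2, norm_smul, norm_smul, Real.norm_of_nonneg ht.1,
        Real.norm_of_nonneg (by linarith [ht.2])]
      ring

section Iteration

variable {T : E → E} {U : Set E} {c : E} {r : ℝ} {μ : ℕ → ℝ} {x : ℕ → E}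

/-- `T` is controlled only on `U`; centring the ball at a fixed point keeps every iterate where the
estimates apply. -/
theorem krasnoselskii_mann_mem (hT : NonexpansiveOn T U) (hr : 0 ≤ r)
    (hC : Metric.closedBall c r ⊆ U) (hc : T c = c) (hμ : ∀ k, 0 ≤ μ k ∧ μ k ≤ 1)
    (hx0 : x 0 ∈ Metric.closedBall c r)
    (hx : ∀ k, x (k + 1) = μ k • T (x k) + (1 - μ k) • x k) (k : ℕ) :
    x k ∈ Metric.closedBall c r := by
  induction k with
  | zero => exact hx0
  | succ k ih =>
    have h := krasnoselskii_mann_step_le hT (hC ih) (hC (Metric.mem_closedBall_self hr)) hc (hμ k)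
    rw [← hx k] at h
    rw [mem_closedBall_iff_norm] at ih ⊢
    exact h.trans ih

theorem krasnoselskii_mann_tendsto_residual (hT : NonexpansiveOn T U) (hxU : ∀ k, x k ∈ U)
    (hcU : c ∈ U) (hc : T c = c) (hμ : ∀ k, 0 ≤ μ k ∧ μ k ≤ 1)
    (hsum : Tendsto (fun N => ∑ k ∈ Finset.range N, μ k * (1 - μ k)) atTop atTop)
    (hx : ∀ k, x (k + 1) = μ k • T (x k) + (1 - μ k) • x k) :
    Tendsto (fun k => T (x k) - x k) atTop (𝓝 0) := by
  have hanti : Antitone (fun k => ‖T (x k) - x k‖) := antitone_nat_of_succ_le fun k =>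
    krasnoselskii_mann_residual hT (hxU k) (hμ k) (hx k) (hxU (k + 1))
  have hw : ∀ k, 0 ≤ μ k * (1 - μ k) := fun k => mul_nonneg (hμ k).1 (by linarith [(hμ k).2])
  have hbound : ∀ N, ∑ k ∈ Finset.range N, μ k * (1 - μ k) * ‖T (x k) - x k‖ ^ 2
      ≤ ‖x 0 - c‖ ^ 2 - ‖x N - c‖ ^ 2 := by
    intro N
    induction N with
    | zero => simp
    | succ N ih =>
      have h := krasnoselskii_mann_step hT (hxU N) hcU hc (hμ N).1
      rw [← hx N] at h
      rw [Finset.sum_range_succ]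
      linarith
  -- The last residual is the smallest, so it can replace all the others in the telescoped sum;
  -- dividing by the divergent sum of weights then gives the limit.
  have hle : ∀ N, (∑ k ∈ Finset.range N, μ k * (1 - μ k)) * ‖T (x N) - x N‖ ^ 2
      ≤ ‖x 0 - c‖ ^ 2 := by
    intro N
    refine le_trans ?_ ((hbound N).trans (sub_le_self _ (sq_nonneg _)))
    rw [Finset.sum_mul]
    refine Finset.sum_le_sum fun k hk => mul_le_mul_of_nonneg_left ?_ (hw k)
    have := hanti (Finset.mem_range.1 hk).le
    dsimp only at this
    gcongr
  have hsq : Tendsto (fun k => ‖T (x k) - x k‖ ^ 2) atTop (𝓝 0) := by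
    refine squeeze_zero' (Eventually.of_forall fun k => sq_nonneg _) ?_
      (hsum.const_div_atTop (‖x 0 - c‖ ^ 2))
    filter_upwards [hsum.eventually_gt_atTop 0] with N hN
    rw [le_div_iff₀ hN, mul_comm]
    exact hle N
  rw [tendsto_zero_iff_norm_tendsto_zero]
  simpa using hsq.sqrt

/-- A cluster point in the compact ball is fixed because the residual vanishes. The distance to that
fixed point is antitone and tends to zero along a subsequence, hence along the whole sequence. -/
theorem krasnoselskii_mann_tendsto [ProperSpace E] (hT : NonexpansiveOn T U)
    (hC : Metric.closedBall c r ⊆ U) (hxC : ∀ k, x k ∈ Metric.closedBall c r)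
    (hμ : ∀ k, 0 ≤ μ k ∧ μ k ≤ 1)
    (hres : Tendsto (fun k => T (x k) - x k) atTop (𝓝 0))
    (hx : ∀ k, x (k + 1) = μ k • T (x k) + (1 - μ k) • x k) :
    ∃ a ∈ Metric.closedBall c r, T a = a ∧ Tendsto x atTop (𝓝 a) := by
  obtain ⟨a, ha, ψ, hψ, hlim⟩ := (isCompact_closedBall c r).tendsto_subseq hxC
  have hdist : Tendsto (fun k => ‖x (ψ k) - a‖) atTop (𝓝 0) :=
    tendsto_iff_norm_sub_tendsto_zero.1 hlim
  have hTlim : Tendsto (fun k => T (x (ψ k))) atTop (𝓝 (T a)) := by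
    rw [tendsto_iff_norm_sub_tendsto_zero]
    exact squeeze_zero (fun _ => norm_nonneg _)
      (fun k => hT _ (hC (hxC _)) _ (hC ha)) hdist
  have hfix : T a = a :=
    sub_eq_zero.1 (tendsto_nhds_unique (hTlim.sub hlim) (hres.comp hψ.tendsto_atTop))
  refine ⟨a, ha, hfix, ?_⟩
  have hanti : Antitone (fun k => ‖x k - a‖) := antitone_nat_of_succ_le fun k => by
    have h := krasnoselskii_mann_step_le hT (hC (hxC k)) (hC ha) hfix (hμ k)
    rwa [← hx k] at h
  rw [tendsto_iff_norm_sub_tendsto_zero]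
  exact (tendsto_iff_tendsto_subseq_of_antitone hanti hψ.tendsto_atTop).2 hdist

end Iteration

/-! ### Proximal points and subgradients -/

section Subgradients

variable {f : E → EReal} {lam : ℝ}

omit [InnerProductSpace ℝ E] in
theorem coe_le_proxObjective_iff {a : ℝ} {x y : E} :
    (a : EReal) ≤ proxObjective f lam x y
      ↔ ((a - 1 / (2 * lam) * ‖y - x‖ ^ 2 : ℝ) : EReal) ≤ f y := by
  unfold proxObjective
  induction f y with
  | bot => rw [EReal.bot_add]; simp only [le_bot_iff, EReal.coe_ne_bot]
  | top => rw [EReal.top_add_coe]; simp only [le_top]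
  | coe b => norm_cast; exact sub_le_iff_le_add.symm

omit [InnerProductSpace ℝ E] in
theorem mem_prox_iff {x p : E} {a : ℝ} (ha : f p = a) :
    p ∈ prox f lam x ↔ ∀ y, ((a + 1 / (2 * lam) * ‖p - x‖ ^ 2
      - 1 / (2 * lam) * ‖y - x‖ ^ 2 : ℝ) : EReal) ≤ f y := by
  refine forall_congr' fun y => ?_
  rw [← coe_le_proxObjective_iff, proxObjective, ha, ← EReal.coe_add]

theorem mem_levelProxSubdiff_iff {p v : E} {a : ℝ} (ha : f p = a) :
    v ∈ levelProxSubdiff f lam p ↔ ∀ y, ((a + (inner ℝ v (y - p)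
      - 1 / (2 * lam) * ‖y - p‖ ^ 2) : ℝ) : EReal) ≤ f y := by
  simp only [levelProxSubdiff, Set.mem_ofPred_eq, ha, EReal.coe_lt_top, true_and, EReal.coe_add]

theorem exists_coe_eq {α : Type*} {f : α → EReal} (hbot : ∀ x, f x ≠ ⊥) {x : α} (hx : f x < ⊤) : ∃ a : ℝ, f x = a :=
  ⟨(f x).toReal, (EReal.coe_toReal hx.ne (hbot x)).symm⟩

/-- Completing the square about `p + lam • v` turns one quadratic minorant into the other. -/
theorem mem_levelProxSubdiff_iff_mem_prox (hlam : 0 < lam) {p v : E} {a : ℝ} (ha : f p = a) :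
    v ∈ levelProxSubdiff f lam p ↔ p ∈ prox f lam (p + lam • v) := by
  rw [mem_levelProxSubdiff_iff ha, mem_prox_iff ha]
  refine forall_congr' fun y => ?_
  have h : a + 1 / (2 * lam) * ‖p - (p + lam • v)‖ ^ 2
      - 1 / (2 * lam) * ‖y - (p + lam • v)‖ ^ 2
      = a + (inner ℝ v (y - p) - 1 / (2 * lam) * ‖y - p‖ ^ 2) := by
    rw [sub_add_cancel_left, norm_neg, ← sub_sub, norm_sub_sq_real (y - p), inner_smul_right,
      real_inner_comm v]
    field_simp
    ring
  rw [h]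

omit [InnerProductSpace ℝ E] in
theorem lt_top_of_mem_prox (hf : ∃ x, f x < ⊤) {x p : E} (hp : p ∈ prox f lam x) : f p < ⊤ := by
  obtain ⟨y, hy⟩ := hf
  have h : proxObjective f lam x p < ⊤ :=
    (hp y).trans_lt (EReal.add_lt_top hy.ne (EReal.coe_ne_top _))
  by_contra hcon
  rw [not_lt_top_iff] at hcon
  rw [proxObjective, hcon, EReal.top_add_coe] at h
  exact h.ne rfl

theorem levelProxSubdiff_subset_regularSubdiff (hlam : 0 < lam) (p : E) :
    levelProxSubdiff f lam p ⊆ regularSubdiff f p := by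
  rintro v ⟨hp, hv⟩
  refine ⟨hp, fun ε hε => ?_⟩
  filter_upwards [Metric.ball_mem_nhds p (show 0 < 2 * lam * ε by positivity)] with y hy
  refine le_trans (add_le_add le_rfl (EReal.coe_le_coe_iff.2 (sub_le_sub_left ?_ _))) (hv y)
  rw [mem_ball_iff_norm] at hy
  have h : 1 / (2 * lam) * ‖y - p‖ ≤ ε := by
    rw [one_div, inv_mul_le_iff₀ (by positivity)]
    exact hy.le
  calc 1 / (2 * lam) * ‖y - p‖ ^ 2 = 1 / (2 * lam) * ‖y - p‖ * ‖y - p‖ := by ring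
    _ ≤ ε * ‖y - p‖ := by gcongr

theorem regularSubdiff_subset_limitingSubdiff (p : E) :
    regularSubdiff f p ⊆ limitingSubdiff f p := fun v hv =>
  ⟨hv.1, fun _ => p, fun _ => v, fun _ => hv, tendsto_const_nhds, tendsto_const_nhds,
    tendsto_const_nhds⟩

omit [InnerProductSpace ℝ E] in
theorem moreauEnvelope_eq_of_mem_prox {x p : E} (hp : p ∈ prox f lam x) :
    moreauEnvelope f lam x = proxObjective f lam x p :=
  le_antisymm (iInf_le _ _) (le_iInf hp)

omit [InnerProductSpace ℝ E] in
theorem moreauEnvelope_le (x : E) : moreauEnvelope f lam x ≤ f x := by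
  refine (iInf_le _ x).trans ?_
  simp [proxObjective]

end Subgradients

/-! ### Subgradients of convex functions -/

section Convex

variable {φ : E → EReal}

/-- The local inequality at `x + t • (y - x)`, compared with the chord, has every term beyond `φ x`
proportional to `t`; dividing by `t` makes it global, up to an error `ε ‖y - x‖`. -/
theorem le_of_mem_regularSubdiff_of_convex (hbot : ∀ x, φ x ≠ ⊥)
    (hconv : EConvexOn Set.univ φ) {x v : E} (hv : v ∈ regularSubdiff φ x) (y : E) :
    φ x + ((inner ℝ v (y - x) : ℝ) : EReal) ≤ φ y := by
  obtain ⟨a, ha⟩ := exists_coe_eq hbot hv.1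
  by_cases hy : φ y < ⊤
  swap
  · rw [not_lt_top_iff.1 hy]; exact le_top
  obtain ⟨b, hb⟩ := exists_coe_eq hbot hy
  rw [ha, hb, ← EReal.coe_add, EReal.coe_le_coe_iff]
  refine le_of_forall_pos_le_add fun δ hδ => ?_
  -- The `+ 1` covers the case `y = x`.
  set ε := δ / (‖y - x‖ + 1) with hεdef
  have hε : 0 < ε := by positivity
  have hεδ : ε * ‖y - x‖ ≤ δ := by
    rw [hεdef, div_mul_eq_mul_div, div_le_iff₀ (by positivity)]
    nlinarith [norm_nonneg (y - x)]
  have hlim : Tendsto (fun t : ℝ => x + t • (y - x)) (𝓝[>] 0) (𝓝 x) := by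
    have : ContinuousAt (fun t : ℝ => x + t • (y - x)) 0 := by fun_prop
    simpa using this.tendsto.mono_left nhdsWithin_le_nhds
  have hev := hlim.eventually (hv.2 ε hε)
  have hsmall : ∀ᶠ t : ℝ in 𝓝[>] 0, t < 1 :=
    (eventually_lt_nhds one_pos).filter_mono nhdsWithin_le_nhds
  obtain ⟨t, ⟨ht, ht1⟩, ht0⟩ := ((hev.and hsmall).and self_mem_nhdsWithin).exists
  have ht0 : 0 < t := ht0
  have hmem := hconv (x := (x, a)) (y := (y, b)) ⟨trivial, ha.le⟩ ⟨trivial, hb.le⟩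
    (by linarith : 0 ≤ 1 - t) ht0.le (by ring)
  have hle : φ (x + t • (y - x)) ≤ (((1 - t) * a + t * b : ℝ) : EReal) := by
    have hpt : x + t • (y - x) = (1 - t) • x + t • y := by module
    rw [hpt]
    exact hmem.2
  have h := ht.trans hle
  rw [ha, ← EReal.coe_add, EReal.coe_le_coe_iff, add_sub_cancel_left, inner_smul_right, norm_smul,
    Real.norm_of_nonneg ht0.le] at h
  have h' : t * (a + inner ℝ v (y - x)) ≤ t * (b + ε * ‖y - x‖) := by linarith
  linarith [le_of_mul_le_mul_left h' ht0]

theorem le_of_mem_limitingSubdiff_of_convex (hbot : ∀ x, φ x ≠ ⊥)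
    (hconv : EConvexOn Set.univ φ) {x v : E} (hv : v ∈ limitingSubdiff φ x) (y : E) :
    φ x + ((inner ℝ v (y - x) : ℝ) : EReal) ≤ φ y := by
  obtain ⟨hx, xs, vs, hreg, hvs, hxs, hφ⟩ := hv
  have hin : Tendsto (fun k => ((inner ℝ (vs k) (y - xs k) : ℝ) : EReal)) atTop
      (𝓝 ((inner ℝ v (y - x) : ℝ) : EReal)) :=
    (continuous_coe_real_ereal.tendsto _).comp (hvs.inner (tendsto_const_nhds.sub hxs))
  have hadd := (EReal.continuousAt_add (p := (φ x, ((inner ℝ v (y - x) : ℝ) : EReal)))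
    (Or.inl hx.ne) (Or.inl (hbot x))).tendsto.comp (hφ.prodMk_nhds hin)
  exact le_of_tendsto hadd (Eventually.of_forall fun k =>
    le_of_mem_regularSubdiff_of_convex hbot hconv (hreg k) y)

end Convex

end Auxiliary

end VarConvex

namespace VarConvex

section ProxNeighborhood

variable {E : Type*} [NormedAddCommGroup E] [InnerProductSpace ℝ E]

/-! ### Consequences of the subgradient inequality between proximal points -/

section Abstract

variable {U : Set E} {P : E → E} {lam : ℝ}

/-- This form is symmetric in `T` and `Id - T`, which yields cocoercivity of the envelope gradient.
-/
theorem firmlyNonexpansiveOn_iff {T : E → E} :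
    FirmlyNonexpansiveOn T U ↔
      ∀ x ∈ U, ∀ y ∈ U, 0 ≤ inner ℝ ((x - y) - (T x - T y)) (T x - T y) := by
  refine forall₂_congr fun x _ => forall₂_congr fun y _ => ?_
  rw [inner_sub_left (x - y), real_inner_self_eq_norm_sq, sub_nonneg]

theorem FirmlyNonexpansiveOn.id_sub (h : FirmlyNonexpansiveOn P U) :
    FirmlyNonexpansiveOn (fun x => x - P x) U := by
  rw [firmlyNonexpansiveOn_iff] at h ⊢
  intro x hx y hy
  have h' := h x hx y hy
  have e1 : x - P x - (y - P y) = (x - y) - (P x - P y) := by abel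
  have e2 : x - y - (x - P x - (y - P y)) = P x - P y := by abel
  rwa [e2, e1, real_inner_comm]

theorem FirmlyNonexpansiveOn.nonexpansiveOn (h : FirmlyNonexpansiveOn P U) :
    NonexpansiveOn P U := by
  intro x hx y hy
  have h1 := (h x hx y hy).trans (real_inner_le_norm _ _)
  by_contra hcon
  push Not at hcon
  nlinarith [norm_nonneg (x - y)]

/-- The nonexpansive partner is the reflection `2 P - Id`. -/
theorem FirmlyNonexpansiveOn.averagedOn (h : FirmlyNonexpansiveOn P U) :
    AveragedOn (1 / 2) P U := by
  refine ⟨fun x => (2 : ℝ) • P x - x, fun x hx y hy => ?_, fun x _ => by module⟩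
  have e : (2 : ℝ) • P x - x - ((2 : ℝ) • P y - y) = (2 : ℝ) • (P x - P y) - (x - y) := by module
  have h' := h x hx y hy
  refine le_of_sq_le_sq ?_ (norm_nonneg _)
  rw [e, norm_sub_sq_real, norm_smul, inner_smul_left, real_inner_comm]
  norm_num [mul_pow]
  linarith

variable {F : E → ℝ}

theorem firmlyNonexpansiveOn_of_subgradient (hlam : 0 < lam)
    (hsub : ∀ u ∈ U, ∀ w ∈ U, F u + inner ℝ ((1 / lam) • (u - P u)) (P w - P u) ≤ F w) :
    FirmlyNonexpansiveOn P U := by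
  rw [firmlyNonexpansiveOn_iff]
  intro u hu w hw
  have h1 := hsub u hu w hw
  have h2 := hsub w hw u hu
  have e : inner ℝ ((u - w) - (P u - P w)) (P u - P w)
      = -lam * (inner ℝ ((1 / lam) • (u - P u)) (P w - P u)
        + inner ℝ ((1 / lam) • (w - P w)) (P u - P w)) := by
    rw [← neg_sub (P u) (P w), inner_neg_right, inner_smul_left, inner_smul_left]
    have : (u - w) - (P u - P w) = (u - P u) - (w - P w) := by abel
    rw [this, inner_sub_left]
    simp only [conj_trivial]
    field_simp
    ring
  rw [e]
  nlinarith

/-- Here `F` stands for `f ∘ P`. The extra squared term is what later yields, with `u` and `w`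
exchanged, the quadratic upper bound needed for differentiability. -/
theorem envelope_subgradient_inequality (hlam : 0 < lam) {u w : E}
    (hsub : F u + inner ℝ ((1 / lam) • (u - P u)) (P w - P u) ≤ F w) :
    F u + 1 / (2 * lam) * ‖P u - u‖ ^ 2 + inner ℝ ((1 / lam) • (u - P u)) (w - u)
      + 1 / (2 * lam) * ‖(w - P w) - (u - P u)‖ ^ 2
      ≤ F w + 1 / (2 * lam) * ‖P w - w‖ ^ 2 := by
  set p := u - P u
  set q := w - P w
  have e1 : P u - u = -p := by simp [p]
  have e2 : P w - w = -q := by simp [q]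
  have e3 : P w - P u = (w - u) - (q - p) := by simp only [p, q]; abel
  rw [e3, inner_smul_left, inner_sub_right p (w - u), inner_sub_right p q] at hsub
  rw [e1, e2, norm_neg, norm_neg, inner_smul_left, norm_sub_sq_real q p, real_inner_comm p q]
  simp only [conj_trivial, real_inner_self_eq_norm_sq] at hsub ⊢
  refine le_trans (le_of_eq ?_) (add_le_add_left hsub _)
  field_simp
  ring

theorem hasGradientAt_of_quadratic_bounds [CompleteSpace E] {e : E → ℝ} {g : E} {u : E} {c : ℝ}
    (hlower : ∀ᶠ w in 𝓝 u, e u + inner ℝ g (w - u) ≤ e w)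
    (hupper : ∀ᶠ w in 𝓝 u, e w ≤ e u + inner ℝ g (w - u) + c * ‖w - u‖ ^ 2) :
    HasGradientAt e g u := by
  rw [hasGradientAt_iff_isLittleO]
  have hO : (fun w => e w - e u - inner ℝ g (w - u)) =O[𝓝 u] fun w => ‖w - u‖ ^ 2 := by
    refine Asymptotics.IsBigO.of_bound c ?_
    filter_upwards [hlower, hupper] with w h1 h2
    rw [Real.norm_of_nonneg (by linarith), Real.norm_of_nonneg (sq_nonneg _)]
    linarith
  refine hO.trans_isLittleO (Asymptotics.isLittleO_norm_right.1 ?_)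
  have hlim : Tendsto (fun w => ‖w - u‖) (𝓝 u) (𝓝 0) := by
    have : Continuous fun w => ‖w - u‖ := by fun_prop
    simpa using this.tendsto u
  have h := (Asymptotics.isLittleO_pow_id (𝕜 := ℝ) one_lt_two).comp_tendsto hlim
  exact h

end Abstract

/-! ### Relative maximal monotonicity, and admissibility from the subgradient inequality -/

variable {f : E → EReal} {lam : ℝ} {U : Set E} {P : E → E}

theorem mem_levelProxSubdiff_iff_of_prox_eq (hbot : ∀ x, f x ≠ ⊥) (hfin : ∃ x, f x < ⊤)
    (hlam : 0 < lam) (hprox : ∀ u ∈ U, prox f lam u = {P u}) {x v : E} (hU : x + lam • v ∈ U) :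
    v ∈ levelProxSubdiff f lam x ↔ x = P (x + lam • v) := by
  rw [← Set.mem_singleton_iff, ← hprox _ hU]
  constructor
  · intro h
    obtain ⟨a, ha⟩ := exists_coe_eq hbot h.1
    exact (mem_levelProxSubdiff_iff_mem_prox hlam ha).1 h
  · intro h
    obtain ⟨a, ha⟩ := exists_coe_eq hbot (lt_top_of_mem_prox hfin h)
    exact (mem_levelProxSubdiff_iff_mem_prox hlam ha).2 h

theorem monotoneRel_levelProxSubdiff (hbot : ∀ x, f x ≠ ⊥) (hfin : ∃ x, f x < ⊤)
    (hlam : 0 < lam) (hprox : ∀ u ∈ U, prox f lam u = {P u}) (hP : FirmlyNonexpansiveOn P U) :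
    MonotoneRel (levelProxSubdiff f lam) {p | p.1 + lam • p.2 ∈ U} := by
  rintro ⟨x, v⟩ ⟨hv, hxv⟩ ⟨y, w⟩ ⟨hw, hyw⟩
  have hx := (mem_levelProxSubdiff_iff_of_prox_eq hbot hfin hlam hprox hxv).1 hv
  have hy := (mem_levelProxSubdiff_iff_of_prox_eq hbot hfin hlam hprox hyw).1 hw
  have h := firmlyNonexpansiveOn_iff.1 hP _ hxv _ hyw
  dsimp only at h ⊢
  rw [← hx, ← hy] at h
  have e : x + lam • v - (y + lam • w) - (x - y) = lam • (v - w) := by module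
  rw [e, inner_smul_left, real_inner_comm] at h
  exact nonneg_of_mul_nonneg_right h hlam

theorem maxMonotoneRel_levelProxSubdiff (hbot : ∀ x, f x ≠ ⊥) (hfin : ∃ x, f x < ⊤)
    (hlam : 0 < lam) (hprox : ∀ u ∈ U, prox f lam u = {P u}) (hP : FirmlyNonexpansiveOn P U) :
    MaxMonotoneRel (levelProxSubdiff f lam) {p | p.1 + lam • p.2 ∈ U} := by
  refine ⟨monotoneRel_levelProxSubdiff hbot hfin hlam hprox hP, ?_⟩
  rintro ⟨A, hsub, hne, hA⟩
  refine hne (Set.Subset.antisymm ?_ hsub)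
  rintro ⟨x, v⟩ ⟨hv, hxv⟩
  refine ⟨?_, hxv⟩
  have hxv : x + lam • v ∈ U := hxv
  set u := x + lam • v with hu
  have hPu : P u + lam • ((1 / lam) • (u - P u)) = u := by
    rw [smul_smul, mul_one_div_cancel hlam.ne', one_smul]; abel
  -- Minty's argument: this graph point has the same `u = x + lam • v` as `(x, v)`, so the
  -- differences of the two components are opposite in direction and monotonicity forces `x = P u`.
  have hmem : (P u, (1 / lam) • (u - P u)) ∈
      graph (levelProxSubdiff f lam) ∩ {p | p.1 + lam • p.2 ∈ U} := by
    have hU : P u + lam • ((1 / lam) • (u - P u)) ∈ U := by rw [hPu]; exact hxv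
    exact ⟨(mem_levelProxSubdiff_iff_of_prox_eq hbot hfin hlam hprox hU).2 (by rw [hPu]), hU⟩
  have h := hA (x, v) ⟨hv, hxv⟩ _ (hsub hmem)
  have e : v - (1 / lam) • (u - P u) = -((1 / lam) • (x - P u)) := by
    have : v = (1 / lam) • (lam • v) := by rw [smul_smul, one_div_mul_cancel hlam.ne', one_smul]
    rw [this, hu]; module
  dsimp only at h
  rw [e, inner_neg_right, inner_smul_right, real_inner_self_eq_norm_sq] at h
  have h0 : ‖x - P u‖ = 0 := by
    have h1 : 0 < 1 / lam := by positivity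
    have h2 : ‖x - P u‖ ^ 2 ≤ 0 := by nlinarith [sq_nonneg ‖x - P u‖]
    exact pow_eq_zero_iff two_ne_zero |>.1 (le_antisymm h2 (sq_nonneg _))
  exact (mem_levelProxSubdiff_iff_of_prox_eq hbot hfin hlam hprox hxv).2
    (sub_eq_zero.1 (norm_eq_zero.1 h0))

theorem isProxNeighborhood_of_subgradient [CompleteSpace E] {xbar : E} (hbot : ∀ x, f x ≠ ⊥)
    (hfin : ∃ x, f x < ⊤) (hlam : 0 < lam) (hopen : IsOpen U) (hconv : Convex ℝ U)
    (hmem : xbar ∈ U) (hcenter : prox f lam xbar = {xbar})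
    (hprox : ∀ u ∈ U, prox f lam u = {P u})
    (hsub : ∀ u ∈ U, ∀ w ∈ U,
      f (P u) + ((inner ℝ ((1 / lam) • (u - P u)) (P w - P u) : ℝ) : EReal) ≤ f (P w)) :
    IsProxNeighborhood f xbar lam U P := by
  have hPmem : ∀ u ∈ U, P u ∈ prox f lam u := fun u hu => by rw [hprox u hu]; rfl
  have hF : ∀ u ∈ U, f (P u) = ((f (P u)).toReal : EReal) := fun u hu =>
    (EReal.coe_toReal (lt_top_of_mem_prox hfin (hPmem u hu)).ne (hbot _)).symm
  have hsubF : ∀ u ∈ U, ∀ w ∈ U, (f (P u)).toReal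
      + inner ℝ ((1 / lam) • (u - P u)) (P w - P u) ≤ (f (P w)).toReal := fun u hu w hw => by
    have h := hsub u hu w hw
    rwa [hF u hu, hF w hw, ← EReal.coe_add, EReal.coe_le_coe_iff] at h
  have henv : ∀ u ∈ U, moreauEnvelope f lam u
      = (((f (P u)).toReal + 1 / (2 * lam) * ‖P u - u‖ ^ 2 : ℝ) : EReal) := fun u hu => by
    rw [moreauEnvelope_eq_of_mem_prox (hPmem u hu), proxObjective, EReal.coe_add, ← hF u hu]
  have hkey : ∀ u ∈ U, ∀ w ∈ U, _ := fun u hu w hw =>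
    envelope_subgradient_inequality (F := fun u => (f (P u)).toReal) hlam (hsubF u hu w hw)
  have hgrad : ∀ u ∈ U, ∀ w ∈ U, (f (P u)).toReal + 1 / (2 * lam) * ‖P u - u‖ ^ 2
      + inner ℝ ((1 / lam) • (u - P u)) (w - u)
      ≤ (f (P w)).toReal + 1 / (2 * lam) * ‖P w - w‖ ^ 2 := fun u hu w hw =>
    le_trans (le_add_of_nonneg_right (by positivity)) (hkey u hu w hw)
  have hfirm : FirmlyNonexpansiveOn P U :=
    firmlyNonexpansiveOn_of_subgradient (F := fun u => (f (P u)).toReal) hlam hsubF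
  refine ⟨hopen, hconv, hmem, hcenter, hprox,
    monotoneRel_levelProxSubdiff hbot hfin hlam hprox hfirm,
    maxMonotoneRel_levelProxSubdiff hbot hfin hlam hprox hfirm, hfirm,
    ⟨1 / 2, by norm_num, by norm_num, hfirm.averagedOn⟩, hfirm.nonexpansiveOn, ?_, ?_,
    fun u => (1 / lam) • (u - P u), ?_, ?_⟩
  · rintro ⟨u, s⟩ ⟨hu, hs⟩ ⟨w, t⟩ ⟨hw, ht⟩ a b ha hb hab
    have hm := hconv hu hw ha hb hab
    refine ⟨hm, ?_⟩
    have hu : u ∈ U := hu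
    have hw : w ∈ U := hw
    have hs : moreauEnvelope f lam u ≤ (s : EReal) := hs
    have ht : moreauEnvelope f lam w ≤ (t : EReal) := ht
    change moreauEnvelope f lam (a • u + b • w) ≤ ((a * s + b * t : ℝ) : EReal)
    have hm : a • u + b • w ∈ U := hm
    set m := a • u + b • w with hmdef
    rw [henv _ hu, EReal.coe_le_coe_iff] at hs
    rw [henv _ hw, EReal.coe_le_coe_iff] at ht
    rw [henv _ hm, EReal.coe_le_coe_iff]
    -- Convexity comes from the affine minorant at the intermediate point `m`: the linear terms
    -- cancel in the convex combination.
    have h1 := hgrad m hm u hu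
    have h2 := hgrad m hm w hw
    have e : a * inner ℝ ((1 / lam) • (m - P m)) (u - m)
        + b * inner ℝ ((1 / lam) • (m - P m)) (w - m) = 0 := by
      rw [← inner_smul_right, ← inner_smul_right, ← inner_add_right]
      have : a • (u - m) + b • (w - m) = 0 := by
        rw [smul_sub, smul_sub, sub_add_sub_comm, ← hmdef, ← add_smul, hab, one_smul, sub_self]
      rw [this, inner_zero_right]
    have hb' : b = 1 - a := by linarith
    have h1' := mul_le_mul_of_nonneg_left (h1.trans hs) ha
    have h2' := mul_le_mul_of_nonneg_left (h2.trans ht) hb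
    rw [mul_add] at h1' h2'
    rw [hb'] at h2' e ⊢
    linarith
  · intro u hu
    rw [henv u hu]
    exact ⟨EReal.coe_ne_bot _, EReal.coe_ne_top _⟩
  · intro u hu
    have hreal : ∀ w ∈ U, (moreauEnvelope f lam w).toReal
        = (f (P w)).toReal + 1 / (2 * lam) * ‖P w - w‖ ^ 2 := fun w hw => by
      rw [henv w hw, EReal.toReal_coe]
    refine hasGradientAt_of_quadratic_bounds (c := 1 / (2 * lam)) ?_ ?_
    · filter_upwards [hopen.mem_nhds hu] with w hw
      rw [hreal u hu, hreal w hw]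
      exact hgrad u hu w hw
    · filter_upwards [hopen.mem_nhds hu] with w hw
      rw [hreal u hu, hreal w hw]
      have h := hkey w hw u hu
      -- Young's inequality: it absorbs the change of gradient between `u` and `w` into the squared
      -- term of `hkey`.
      have h1 : 0 ≤ 1 / (2 * lam) * ‖((u - P u) - (w - P w)) + (w - u)‖ ^ 2 := by positivity
      rw [norm_add_sq_real, inner_sub_left] at h1
      rw [inner_smul_left, ← neg_sub w u, inner_neg_right] at h
      rw [inner_smul_left]
      simp only [conj_trivial] at h ⊢
      have e : (1 / lam) = 2 * (1 / (2 * lam)) := by field_simp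
      rw [e] at h ⊢
      linarith
  · have e : (fun x => lam • (fun u => (1 / lam) • (u - P u)) x) = fun x => x - P x := by
      funext x
      rw [smul_smul, mul_one_div_cancel hlam.ne', one_smul]
    rw [CocoerciveOn, e]
    exact hfirm.id_sub

end ProxNeighborhood

end VarConvex

namespace VarConvex

section Localization

variable {E : Type*} [NormedAddCommGroup E] [InnerProductSpace ℝ E]
variable {f : E → EReal} {xbar : E} {lam lamBar a : ℝ}

/-! ### Proximal points near a point where `f` has a global quadratic minorant -/

/-- Near `xbar` the constant `a` is already a minorant; away from it, a steep enough parabola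
centred at `xbar` lies below the one centred at `x0`. -/
theorem exists_quadratic_minorant {lam0 m : ℝ} {x0 : E} (hlam0 : 0 < lam0)
    (hbound : ∀ y, ((m - 1 / (2 * lam0) * ‖y - x0‖ ^ 2 : ℝ) : EReal) ≤ f y)
    (hloc : ∀ᶠ y in 𝓝 xbar, (a : EReal) ≤ f y) :
    ∃ lamBar : ℝ, 0 < lamBar ∧ lamBar ≤ lam0 ∧
      ∀ y, ((a - 1 / (2 * lamBar) * ‖y - xbar‖ ^ 2 : ℝ) : EReal) ≤ f y := by
  obtain ⟨δ, hδ, hball⟩ := Metric.eventually_nhds_iff_ball.1 hloc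
  set D := ‖xbar - x0‖ ^ 2
  set M := |a - m + 1 / lam0 * D|
  -- The first term pays for recentring from `x0` to `xbar`, with a factor 2 lost to the
  -- parallelogram law; the second beats the constant `M` outside the `δ`-ball.
  set L := 1 / lam0 + M / δ ^ 2 with hL
  have hLpos : 0 < L := by positivity
  have hinv : 1 / (2 * (1 / (2 * L))) = L := by field_simp
  refine ⟨1 / (2 * L), by positivity, ?_, fun y => ?_⟩
  · rw [div_le_iff₀ (by positivity), hL]
    have h1 : lam0 * (1 / lam0) = 1 := mul_one_div_cancel hlam0.ne'
    have h2 : 0 ≤ lam0 * (M / δ ^ 2) := by positivity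
    linarith
  rw [hinv]
  by_cases hy : ‖y - xbar‖ < δ
  · refine le_trans (EReal.coe_le_coe_iff.2 ?_) (hball y (mem_ball_iff_norm.2 hy))
    exact sub_le_self _ (by positivity)
  · refine le_trans (EReal.coe_le_coe_iff.2 ?_) (hbound y)
    have h1 : ‖y - x0‖ ^ 2 ≤ 2 * (‖y - xbar‖ ^ 2 + D) := by
      have h := parallelogram_law_with_norm ℝ (y - xbar) (xbar - x0)
      rw [sub_add_sub_cancel] at h
      nlinarith [sq_nonneg ‖y - xbar - (xbar - x0)‖]
    have h2 : 1 / (2 * lam0) * ‖y - x0‖ ^ 2 ≤ 1 / lam0 * (‖y - xbar‖ ^ 2 + D) := by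
      calc 1 / (2 * lam0) * ‖y - x0‖ ^ 2
          ≤ 1 / (2 * lam0) * (2 * (‖y - xbar‖ ^ 2 + D)) := by gcongr
        _ = 1 / lam0 * (‖y - xbar‖ ^ 2 + D) := by field_simp
    have h3 : M ≤ M / δ ^ 2 * ‖y - xbar‖ ^ 2 := by
      rw [div_mul_eq_mul_div, le_div_iff₀ (by positivity)]
      push Not at hy
      gcongr
    have h4 : a - m + 1 / lam0 * D ≤ M := le_abs_self _
    rw [hL, add_mul]
    linarith

/-- Since `lam < lamBar`, the proximal term outweighs the minorant's curvature. The bound makes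
minimization compact, and at `u = xbar` it leaves only `xbar`. -/
theorem norm_sub_le_of_proxObjective_le (hlam : 0 < lam) (hlt : lam < lamBar)
    (ha : f xbar = a)
    (hmin : ∀ y, ((a - 1 / (2 * lamBar) * ‖y - xbar‖ ^ 2 : ℝ) : EReal) ≤ f y)
    {u y : E} (hy : proxObjective f lam u y ≤ proxObjective f lam u xbar) :
    ‖y - xbar‖ ≤ 2 * lamBar / (lamBar - lam) * ‖u - xbar‖ := by
  have hlamBar : 0 < lamBar := hlam.trans hlt
  have h1 : ((a - 1 / (2 * lamBar) * ‖y - xbar‖ ^ 2 : ℝ) : EReal)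
      + ((1 / (2 * lam) * ‖y - u‖ ^ 2 : ℝ) : EReal)
      ≤ (a : EReal) + ((1 / (2 * lam) * ‖xbar - u‖ ^ 2 : ℝ) : EReal) := by
    rw [← ha]
    exact le_trans (add_le_add (hmin y) le_rfl) hy
  rw [← EReal.coe_add, ← EReal.coe_add, EReal.coe_le_coe_iff] at h1
  have e1 : y - u = (y - xbar) - (u - xbar) := by abel
  rw [e1, norm_sub_rev xbar u, norm_sub_sq_real (y - xbar) (u - xbar)] at h1
  have h2 := real_inner_le_norm (y - xbar) (u - xbar)
  set s := ‖y - xbar‖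
  set t := ‖u - xbar‖
  have hs : 0 ≤ s := norm_nonneg _
  have ht : 0 ≤ t := norm_nonneg _
  have h3 : (1 / (2 * lam) - 1 / (2 * lamBar)) * s ^ 2 ≤ 1 / lam * (s * t) := by
    have h4 : 1 / lam * inner ℝ (y - xbar) (u - xbar) ≤ 1 / lam * (s * t) := by gcongr
    have e : 1 / lam = 2 * (1 / (2 * lam)) := by field_simp
    rw [e] at h4 ⊢
    linarith
  have e2 : 1 / (2 * lam) - 1 / (2 * lamBar) = (lamBar - lam) / (2 * lam * lamBar) := by
    field_simp
  have h5 : (lamBar - lam) * s ^ 2 ≤ 2 * lamBar * (s * t) := by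
    rw [e2, div_mul_eq_mul_div, div_le_iff₀ (by positivity)] at h3
    calc _ ≤ _ := h3
      _ = 2 * lamBar * (s * t) := by field_simp
  rw [div_mul_eq_mul_div, le_div_iff₀ (by linarith)]
  rcases hs.eq_or_lt with h0 | h0
  · rw [← h0]; simp only [zero_mul]; positivity
  · exact le_of_mul_le_mul_left (by linarith) h0

omit [InnerProductSpace ℝ E] in
theorem lowerSemicontinuous_proxObjective (hf : LowerSemicontinuous f) (u : E) :
    LowerSemicontinuous (proxObjective f lam u) := by
  refine hf.add' (Continuous.lowerSemicontinuous ?_) fun x => EReal.continuousAt_add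
    (Or.inr (EReal.coe_ne_bot _)) (Or.inr (EReal.coe_ne_top _))
  exact continuous_coe_real_ereal.comp (by fun_prop)

theorem prox_nonempty [ProperSpace E] (hf : LowerSemicontinuous f) (hlam : 0 < lam)
    (hlt : lam < lamBar) (ha : f xbar = a)
    (hmin : ∀ y, ((a - 1 / (2 * lamBar) * ‖y - xbar‖ ^ 2 : ℝ) : EReal) ≤ f y) (u : E) :
    (prox f lam u).Nonempty := by
  have hR : 0 ≤ 2 * lamBar / (lamBar - lam) * ‖u - xbar‖ :=
    mul_nonneg (div_nonneg (by linarith) (by linarith)) (norm_nonneg _)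
  have hx := Metric.mem_closedBall_self (x := xbar) hR
  obtain ⟨p, -, hp⟩ := LowerSemicontinuousOn.exists_isMinOn ⟨xbar, hx⟩ (isCompact_closedBall _ _)
    ((lowerSemicontinuous_proxObjective (lam := lam) hf u).lowerSemicontinuousOn _)
  refine ⟨p, fun z => ?_⟩
  rcases le_total (proxObjective f lam u z) (proxObjective f lam u xbar) with h | h
  · exact hp (mem_closedBall_iff_norm.2 (norm_sub_le_of_proxObjective_le hlam hlt ha hmin h))
  · exact (hp hx).trans h

omit [InnerProductSpace ℝ E] in
theorem apply_le_of_mem_prox (hlam : 0 < lam) (ha : f xbar = a) {u p : E}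
    (hp : p ∈ prox f lam u) :
    f p ≤ ((a + 1 / (2 * lam) * ‖u - xbar‖ ^ 2 : ℝ) : EReal) := by
  have h := hp xbar
  rw [proxObjective, proxObjective, ha, ← EReal.coe_add, norm_sub_rev xbar u] at h
  refine le_trans (le_add_of_nonneg_right ?_) h
  exact_mod_cast (by positivity : 0 ≤ 1 / (2 * lam) * ‖p - u‖ ^ 2)

theorem one_div_smul_sub_mem_limitingSubdiff (hbot : ∀ x, f x ≠ ⊥) (hfin : ∃ x, f x < ⊤)
    (hlam : 0 < lam) {u p : E} (hp : p ∈ prox f lam u) :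
    (1 / lam) • (u - p) ∈ limitingSubdiff f p := by
  obtain ⟨b, hb⟩ := exists_coe_eq hbot (lt_top_of_mem_prox hfin hp)
  refine regularSubdiff_subset_limitingSubdiff p
    (levelProxSubdiff_subset_regularSubdiff hlam p ?_)
  rw [mem_levelProxSubdiff_iff_mem_prox hlam hb, smul_smul, mul_one_div_cancel hlam.ne', one_smul,
    add_sub_cancel]
  exact hp

/-! ### Existence of the neighborhoods -/

/-- `0` is also a subgradient of `φ` at `xbar`, so `xbar` minimizes `φ`, which lies below `f` nearby
and agrees with it at `xbar`. -/
theorem VariationallyConvexAt.eventually_le (hbot : ∀ x, f x ≠ ⊥)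
    (hvc : VariationallyConvexAt f xbar 0) : ∀ᶠ y in 𝓝 xbar, f xbar ≤ f y := by
  obtain ⟨h0, U, hU, V, hV, -, -, φ, hφbot, -, hφ, hle, ε, hε, hgraph, heq⟩ := hvc
  have hlt : f xbar < f xbar + (ε : EReal) := by
    obtain ⟨a, ha⟩ := exists_coe_eq hbot h0.1
    rw [ha, ← EReal.coe_add, EReal.coe_lt_coe_iff]
    linarith
  have hmem : (xbar, (0 : E)) ∈ (U ×ˢ V) ∩ graph (limitingSubdiff φ) := by
    rw [← hgraph]
    exact ⟨⟨⟨mem_of_mem_nhds hU, hlt⟩, mem_of_mem_nhds hV⟩, h0⟩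
  have hx : f xbar = φ xbar := heq _ hmem
  filter_upwards [hU] with y hy
  have h := le_of_mem_limitingSubdiff_of_convex hφbot hφ hmem.2 y
  rw [inner_zero_left, EReal.coe_zero, add_zero, ← hx] at h
  exact h.trans (hle y hy)

theorem VariationallyConvexAt.exists_subgradient_inequality
    (hvc : VariationallyConvexAt f xbar 0) :
    ∃ N ∈ 𝓝 xbar, ∃ V ∈ 𝓝 (0 : E), ∃ ε : ℝ, 0 < ε ∧
      ∀ p ∈ N, f p < f xbar + (ε : EReal) → ∀ v ∈ V, v ∈ limitingSubdiff f p →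
      ∀ q ∈ N, f q < f xbar + (ε : EReal) → ∀ w ∈ V, w ∈ limitingSubdiff f q →
        f p + ((inner ℝ v (q - p) : ℝ) : EReal) ≤ f q := by
  obtain ⟨-, U, hU, V, hV, -, -, φ, hφbot, -, hφ, hle, ε, hε, hgraph, heq⟩ := hvc
  refine ⟨U, hU, V, hV, ε, hε, fun p hp hfp v hv hvp q hq hfq w hw hwq => ?_⟩
  have hmp : (p, v) ∈ (U ×ˢ V) ∩ graph (limitingSubdiff φ) := by
    rw [← hgraph]; exact ⟨⟨⟨hp, hfp⟩, hv⟩, hvp⟩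
  have hmq : (q, w) ∈ (U ×ˢ V) ∩ graph (limitingSubdiff φ) := by
    rw [← hgraph]; exact ⟨⟨⟨hq, hfq⟩, hw⟩, hwq⟩
  rw [heq _ hmp, heq _ hmq]
  exact le_of_mem_limitingSubdiff_of_convex hφbot hφ hmp.2 q

theorem exists_isProxNeighborhood [CompleteSpace E] [ProperSpace E]
    (hbot : ∀ x, f x ≠ ⊥) (hf : LowerSemicontinuous f)
    (hvc : VariationallyConvexAt f xbar 0) (hlam : 0 < lam) (hlt : lam < lamBar)
    (ha : f xbar = a)
    (hmin : ∀ y, ((a - 1 / (2 * lamBar) * ‖y - xbar‖ ^ 2 : ℝ) : EReal) ≤ f y) :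
    ∃ (U : Set E) (P : E → E), IsProxNeighborhood f xbar lam U P := by
  obtain ⟨N, hN, V, hV, ε, hε, hsub⟩ := hvc.exists_subgradient_inequality
  have hfin : ∃ x, f x < ⊤ := ⟨xbar, hvc.1.1⟩
  -- An arbitrary selection; uniqueness of proximal points is proved below, only on the ball.
  choose P hP using prox_nonempty hf hlam hlt ha hmin
  have hK : ∀ {u p : E}, p ∈ prox f lam u →
      ‖p - xbar‖ ≤ 2 * lamBar / (lamBar - lam) * ‖u - xbar‖ := fun hp =>
    norm_sub_le_of_proxObjective_le hlam hlt ha hmin (hp xbar)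
  set K := 2 * lamBar / (lamBar - lam)
  obtain ⟨η, hη, hηN⟩ := Metric.mem_nhds_iff.1 hN
  obtain ⟨θ, hθ, hθV⟩ := Metric.mem_nhds_iff.1 hV
  -- The three smallness conditions put the proximal point in `N`, its subgradient in `V`, and its
  -- value below `f xbar + ε`.
  have h1 : ∀ᶠ u in 𝓝 xbar, K * ‖u - xbar‖ < η := by
    have : Continuous fun u : E => K * ‖u - xbar‖ := by fun_prop
    exact (this.tendsto xbar).eventually_lt_const (by simpa using hη)
  have h2 : ∀ᶠ u in 𝓝 xbar, 1 / lam * (‖u - xbar‖ + K * ‖u - xbar‖) < θ := by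
    have : Continuous fun u : E => 1 / lam * (‖u - xbar‖ + K * ‖u - xbar‖) := by fun_prop
    exact (this.tendsto xbar).eventually_lt_const (by simpa using hθ)
  have h3 : ∀ᶠ u in 𝓝 xbar, 1 / (2 * lam) * ‖u - xbar‖ ^ 2 < ε := by
    have : Continuous fun u : E => 1 / (2 * lam) * ‖u - xbar‖ ^ 2 := by fun_prop
    exact (this.tendsto xbar).eventually_lt_const (by simpa using hε)
  obtain ⟨δ, hδ, hball⟩ := Metric.eventually_nhds_iff_ball.1 (h1.and (h2.and h3))
  have hloc : ∀ u ∈ Metric.ball xbar δ, ∀ p ∈ prox f lam u,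
      p ∈ N ∧ f p < f xbar + (ε : EReal) ∧ (1 / lam) • (u - p) ∈ V := by
    intro u hu p hp
    obtain ⟨hu1, hu2, hu3⟩ := hball u hu
    refine ⟨hηN (mem_ball_iff_norm.2 ((hK hp).trans_lt hu1)), ?_, hθV ?_⟩
    · refine (apply_le_of_mem_prox hlam ha hp).trans_lt ?_
      rw [ha, ← EReal.coe_add, EReal.coe_lt_coe_iff]
      linarith
    · rw [mem_ball_zero_iff, norm_smul, Real.norm_of_nonneg (by positivity)]
      refine lt_of_le_of_lt ?_ hu2
      gcongr
      calc ‖u - p‖ = ‖(u - xbar) - (p - xbar)‖ := by rw [sub_sub_sub_cancel_right]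
        _ ≤ ‖u - xbar‖ + ‖p - xbar‖ := norm_sub_le _ _
        _ ≤ _ := by gcongr; exact hK hp
  have hineq : ∀ u ∈ Metric.ball xbar δ, ∀ p ∈ prox f lam u, ∀ w ∈ Metric.ball xbar δ,
      ∀ q ∈ prox f lam w,
      f p + ((inner ℝ ((1 / lam) • (u - p)) (q - p) : ℝ) : EReal) ≤ f q := by
    intro u hu p hp w hw q hq
    obtain ⟨hp1, hp2, hp3⟩ := hloc u hu p hp
    obtain ⟨hq1, hq2, hq3⟩ := hloc w hw q hq
    exact hsub p hp1 hp2 _ hp3 (one_div_smul_sub_mem_limitingSubdiff hbot hfin hlam hp)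
      q hq1 hq2 _ hq3 (one_div_smul_sub_mem_limitingSubdiff hbot hfin hlam hq)
  have hunique : ∀ u ∈ Metric.ball xbar δ, ∀ p ∈ prox f lam u, ∀ q ∈ prox f lam u, p = q := by
    intro u hu p hp q hq
    have hpq := hineq u hu p hp u hu q hq
    have hqp := hineq u hu q hq u hu p hp
    obtain ⟨b, hb⟩ := exists_coe_eq hbot (lt_top_of_mem_prox hfin hp)
    obtain ⟨c, hc⟩ := exists_coe_eq hbot (lt_top_of_mem_prox hfin hq)
    rw [hb, hc, ← EReal.coe_add, EReal.coe_le_coe_iff] at hpq hqp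
    -- Adding the inequalities for two proximal points of the same `u` cancels `u` and leaves `‖q -
    -- p‖ ^ 2 / lam ≤ 0`.
    have e : inner ℝ ((1 / lam) • (u - p)) (q - p) + inner ℝ ((1 / lam) • (u - q)) (p - q)
        = 1 / lam * ‖q - p‖ ^ 2 := by
      rw [← neg_sub q p, inner_neg_right, ← sub_eq_add_neg, ← inner_sub_left, ← smul_sub,
        sub_sub_sub_cancel_left, inner_smul_left, real_inner_self_eq_norm_sq, conj_trivial]
    have h4 : 1 / lam * ‖q - p‖ ^ 2 ≤ 0 := by linarith
    have h5 : ‖q - p‖ ^ 2 ≤ 0 := by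
      by_contra hcon
      push Not at hcon
      exact absurd h4 (not_le.2 (by positivity))
    have h6 : ‖q - p‖ = 0 := (pow_eq_zero_iff two_ne_zero).1 (le_antisymm h5 (sq_nonneg _))
    exact (sub_eq_zero.1 (norm_eq_zero.1 h6)).symm
  have hcenter : prox f lam xbar = {xbar} := by
    have : ∀ p ∈ prox f lam xbar, p = xbar := fun p hp => by
      have h := hK hp
      rw [sub_self, norm_zero, mul_zero] at h
      exact sub_eq_zero.1 (norm_le_zero_iff.1 h)
    exact Set.eq_singleton_iff_nonempty_unique_mem.2 ⟨⟨_, hP xbar⟩, this⟩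
  exact ⟨Metric.ball xbar δ, P, isProxNeighborhood_of_subgradient hbot hfin hlam Metric.isOpen_ball
    (convex_ball _ _) (Metric.mem_ball_self hδ) hcenter
    (fun u hu => Set.eq_singleton_iff_unique_mem.2 ⟨hP u, fun q hq => hunique u hu q hq _ (hP u)⟩)
    (fun u hu w hw => hineq u hu _ (hP u) w hw _ (hP w))⟩

/-! ### Fixed points are local minimizers -/

theorem isLocalMin_of_mem_fixProx (hbot : ∀ x, f x ≠ ⊥) (hfin : ∃ x, f x < ⊤) {U : Set E}
    (hU : IsOpen U) (hconv : EConvexOn U (moreauEnvelope f lam)) {z : E} (hz : z ∈ U)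
    (hfix : z ∈ fixProx f lam) : IsLocalMin f z := by
  have hzp : z ∈ prox f lam z := hfix
  obtain ⟨a, ha⟩ := exists_coe_eq hbot (lt_top_of_mem_prox hfin hzp)
  have hez : moreauEnvelope f lam z = (a : EReal) := by
    rw [moreauEnvelope_eq_of_mem_prox hzp, proxObjective, ha, sub_self, norm_zero]
    simp
  filter_upwards [hU.mem_nhds hz] with y hy
  by_contra hcon
  push Not at hcon
  have hlt : moreauEnvelope f lam y < (a : EReal) := (moreauEnvelope_le y).trans_lt (ha ▸ hcon)
  obtain ⟨b, hyb, hba⟩ := EReal.lt_iff_exists_real_btwn.1 hlt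
  rw [EReal.coe_lt_coe_iff] at hba
  have hlim : Tendsto (fun t : ℝ => z - t • (y - z)) (𝓝[>] 0) (𝓝 z) := by
    have : ContinuousAt (fun t : ℝ => z - t • (y - z)) 0 := by fun_prop
    simpa using this.tendsto.mono_left nhdsWithin_le_nhds
  have hsmall : ∀ᶠ t : ℝ in 𝓝[>] 0, 1 / (2 * lam) * t * ‖y - z‖ ^ 2 < a - b := by
    have : Continuous fun t : ℝ => 1 / (2 * lam) * t * ‖y - z‖ ^ 2 := by fun_prop
    exact ((this.tendsto 0).eventually_lt_const (by simpa using hba)).filter_mono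
      nhdsWithin_le_nhds
  obtain ⟨t, ⟨htU, ht1⟩, ht0⟩ :=
    (((hlim.eventually (hU.mem_nhds hz)).and hsmall).and self_mem_nhdsWithin).exists
  have ht0 : 0 < t := ht0
  -- Reflecting past `z` puts `z` between `w` and `y`. If `f y < f z`, convexity demands a rise of
  -- the envelope at `w` linear in `t`, yet testing the envelope with `z` allows only order `t ^ 2`.
  set w := z - t • (y - z) with hw
  have hew : moreauEnvelope f lam w
      ≤ ((a + 1 / (2 * lam) * (t ^ 2 * ‖y - z‖ ^ 2) : ℝ) : EReal) := by
    refine (iInf_le _ z).trans (le_of_eq ?_)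
    rw [proxObjective, ha, ← EReal.coe_add, hw, sub_sub_cancel, norm_smul, mul_pow,
      Real.norm_eq_abs, sq_abs]
  have hmem := hconv (x := (w, _)) (y := (y, b)) ⟨htU, hew⟩ ⟨hy, hyb.le⟩
    (by positivity : 0 ≤ 1 / (1 + t)) (by positivity : 0 ≤ t / (1 + t)) (by field_simp)
  have hpt : (1 / (1 + t)) • w + (t / (1 + t)) • y = z := by
    have h1 : (1 / (1 + t)) • w + (t / (1 + t)) • y = (1 / (1 + t)) • (w + t • y) := by
      rw [smul_add, smul_smul]; congr 2; ring
    have h2 : w + t • y = (1 + t) • z := by rw [hw]; module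
    rw [h1, h2, smul_smul, one_div_mul_cancel (by positivity), one_smul]
  have hle : moreauEnvelope f lam ((1 / (1 + t)) • w + (t / (1 + t)) • y) ≤
      ((1 / (1 + t) * (a + 1 / (2 * lam) * (t ^ 2 * ‖y - z‖ ^ 2)) + t / (1 + t) * b : ℝ) : EReal) :=
    hmem.2
  rw [hpt, hez, EReal.coe_le_coe_iff, div_mul_eq_mul_div 1 (1 + t), div_mul_eq_mul_div t (1 + t),
    ← add_div, le_div_iff₀ (by positivity)] at hle
  linarith [mul_lt_mul_of_pos_left ht1 ht0]

end Localization

end VarConvex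

/-! ### The main theorem -/

theorem mainTheorem10 (n : ℕ) (f : EuclideanSpace ℝ (Fin n) → EReal)
    (xbar : EuclideanSpace ℝ (Fin n))
    (hproper : VarConvex.Proper f) (hlsc : LowerSemicontinuous f)
    (hbdd : VarConvex.ProxBounded f)
    (hvc : VarConvex.VariationallyConvexAt f xbar 0)
    (hpr : VarConvex.ProxRegularAround f xbar) :
    -- the stepsizes `lam` and neighborhoods `U` to which the algorithm applies do exist
    (∃ lamBar : ℝ, 0 < lamBar ∧ (lamBar : EReal) ≤ VarConvex.proxThreshold f ∧
      ∀ lam : ℝ, 0 < lam → lam < lamBar →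
        ∃ (U : Set (EuclideanSpace ℝ (Fin n)))
          (P : EuclideanSpace ℝ (Fin n) → EuclideanSpace ℝ (Fin n)),
          VarConvex.IsProxNeighborhood f xbar lam U P) ∧
    -- and the algorithm works for each of them
    (∀ lam : ℝ, 0 < lam → (lam : EReal) < VarConvex.proxThreshold f →
      ∀ (U : Set (EuclideanSpace ℝ (Fin n)))
        (P : EuclideanSpace ℝ (Fin n) → EuclideanSpace ℝ (Fin n)),
        VarConvex.IsProxNeighborhood f xbar lam U P →
      ∀ r : ℝ, 0 < r → Metric.closedBall xbar r ⊆ interior U →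
        VarConvex.ProxRegularOn f (Metric.closedBall xbar r) →
      ∀ μ : ℕ → ℝ, (∀ k, 0 ≤ μ k ∧ μ k ≤ 1) →
        Tendsto (fun N => ∑ k ∈ Finset.range N, μ k * (1 - μ k)) atTop atTop →
      ∀ x : ℕ → EuclideanSpace ℝ (Fin n), x 0 ∈ Metric.closedBall xbar r →
        (∀ k, x (k + 1) = μ k • P (x k) + (1 - μ k) • x k) →
        (VarConvex.fixProx f lam ∩ Metric.closedBall xbar r).Nonempty ∧
        (∀ k, x k ∈ Metric.closedBall xbar r) ∧
        VarConvex.FejerMonotone x (VarConvex.fixProx f lam ∩ Metric.closedBall xbar r) ∧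
        Tendsto (fun k => P (x k) - x k) atTop (𝓝 0) ∧
        ∃ xstar ∈ VarConvex.fixProx f lam ∩ Metric.closedBall xbar r,
          Tendsto x atTop (𝓝 xstar) ∧ IsLocalMin f xstar) := by
  obtain ⟨hbot, hfin⟩ := hproper
  obtain ⟨a, ha⟩ := VarConvex.exists_coe_eq hbot hvc.1.1
  refine ⟨?_, ?_⟩
  · obtain ⟨lam0, hlam0, x0, hx0⟩ := hbdd
    obtain ⟨m, -, hm⟩ := EReal.lt_iff_exists_real_btwn.1 hx0
    have hbound : ∀ y, ((m - 1 / (2 * lam0) * ‖y - x0‖ ^ 2 : ℝ) : EReal) ≤ f y := fun y =>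
      VarConvex.coe_le_proxObjective_iff.1 (hm.le.trans (iInf_le _ y))
    have hloc := hvc.eventually_le hbot
    rw [ha] at hloc
    obtain ⟨lamBar, hpos, hle, hmin⟩ := VarConvex.exists_quadratic_minorant hlam0 hbound hloc
    refine ⟨lamBar, hpos, ?_, fun lam hlam hlt =>
      VarConvex.exists_isProxNeighborhood hbot hlsc hvc hlam hlt ha hmin⟩
    -- `lam0` is one of the parameters whose supremum is the threshold.
    exact (EReal.coe_le_coe_iff.2 hle).trans (le_sSup ⟨lam0, rfl, hlam0, x0, hx0⟩)
  · intro lam hlam _ U P hU r hr hsub _ μ hμ hsum x hx0 hx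
    have hCU : Metric.closedBall xbar r ⊆ U := hsub.trans interior_subset
    have hfix : ∀ z ∈ U, z ∈ VarConvex.fixProx f lam ↔ P z = z := fun z hz => by
      change z ∈ VarConvex.prox f lam z ↔ _
      rw [hU.prox_eq z hz, Set.mem_singleton_iff, eq_comm]
    have hc : P xbar = xbar := Set.singleton_injective
      ((hU.prox_eq xbar hU.mem).symm.trans hU.prox_center)
    have hT := hU.nonexpansive
    have hmem := VarConvex.krasnoselskii_mann_mem hT hr.le hCU hc hμ hx0 hx
    have hres := VarConvex.krasnoselskii_mann_tendsto_residual hT (fun k => hCU (hmem k)) hU.mem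
      hc hμ hsum hx
    obtain ⟨xs, hxsC, hxs, hlim⟩ := VarConvex.krasnoselskii_mann_tendsto hT hCU hmem hμ hres hx
    have hxsfix := (hfix xs (hCU hxsC)).2 hxs
    refine ⟨⟨xs, hxsfix, hxsC⟩, hmem, fun z hz k => ?_, hres, xs, ⟨hxsfix, hxsC⟩, hlim,
      VarConvex.isLocalMin_of_mem_fixProx hbot hfin hU.isOpen hU.envelope_convex (hCU hxsC)
        hxsfix⟩
    rw [hx k]
    exact VarConvex.krasnoselskii_mann_step_le hT (hCU (hmem k)) (hCU hz.2)
      ((hfix z (hCU hz.2)).1 hz.1) (hμ k)
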